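/- All graphs are finite and simple. A graph is \emph{planar} if it can be drawn in the plane with its vertices as distinct points and each edge as a polygonal curve joining its two ends, such that no edge passes through a vertex other than its ends and any two distinct edges meet only in common ends. A \emph{total-$k$-coloring} of a graph assigns to each vertex and each edge a color from a fixed set of $k$ colors such that adjacent vertices receive distinct colors, distinct edges sharing an end receive distinct colors, and no edge receives the color of one of its ends. If $H$ is a (not necessarily induced or spanning) subgraph of $G$, a total-$k$-coloring $\varphi$ of $H$ is a \emph{total-$k$-coloring of $H$ in $G$} if, in addition, any two vertices of $H$ that are adjacent in $G$ receive distinct colors under $\varphi$. Theorem. Let $G$ be a planar graph with maximum degree $\Delta$, and let $H$ be a subgraph of $G$ with maximum degree $d$ (where a graph without vertices has maximum degree $0$). Then every total-$(\Delta+d+6)$-coloring $\varphi$ of $H$ in $G$ extends to $G$; that is, there is a total-$(\Delta+d+6)$-coloring of $G$ that agrees with $\varphi$ on all vertices and edges of $H$. -/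

import Mathlib

/-- The Euclidean plane. -/
abbrev Plane : Type := EuclideanSpace ℝ (Fin 2)

/-- `S` is a polygonal curve from `a` to `b`: the union of finitely many consecutive line
segments `[p 0, p 1], [p 1, p 2], …, [p (n - 1), p n]` with `p 0 = a` and `p n = b`. -/
def IsPolygonalCurve (a b : Plane) (S : Set Plane) : Prop :=
  ∃ (n : ℕ) (p : ℕ → Plane), p 0 = a ∧ p n = b ∧
    S = ⋃ i ∈ Set.Iio n, segment ℝ (p i) (p (i + 1))

/-- A drawing of `G` in the plane without crossings: the vertices are drawn as distinct points,
each edge as a polygonal curve joining its two ends and containing no other vertex, and two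
distinct edges meet only in common ends. -/
structure IsPlanarDrawing {V : Type*} (G : SimpleGraph V)
    (point : V → Plane) (curve : G.edgeSet → Set Plane) : Prop where
  point_injective : Function.Injective point
  isPolygonalCurve : ∀ (u v : V) (h : G.Adj u v),
    IsPolygonalCurve (point u) (point v) (curve ⟨s(u, v), h⟩)
  mem_of_point_mem : ∀ (e : G.edgeSet) (w : V), point w ∈ curve e → w ∈ (e : Sym2 V)
  no_crossing : ∀ e f : G.edgeSet, e ≠ f → ∀ x ∈ curve e ∩ curve f,
    ∃ w : V, w ∈ (e : Sym2 V) ∧ w ∈ (f : Sym2 V) ∧ x = point w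

/-- A graph is planar if it has a drawing in the plane without crossings. -/
def SimpleGraph.IsPlanar {V : Type*} (G : SimpleGraph V) : Prop :=
  ∃ (point : V → Plane) (curve : G.edgeSet → Set Plane), IsPlanarDrawing G point curve

/-- A total-`k`-coloring of `G`: a proper coloring of the vertices together with a proper coloring
of the edges, both with colors from `Fin k`, in which no edge has the color of one of its ends. -/
structure TotalColoring {V : Type*} (G : SimpleGraph V) (k : ℕ) where
  vert : G.Coloring (Fin k)
  edge : G.lineGraph.Coloring (Fin k)
  edge_ne_vert : ∀ (e : G.edgeSet) (v : V), v ∈ (e : Sym2 V) → edge e ≠ vert v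

/-- A total coloring of the subgraph `H` is a total coloring of `H` in `G` if vertices of `H` that
are adjacent in `G` (and possibly not in `H`) receive distinct colors. -/
def TotalColoring.IsColoringIn {V : Type*} {G : SimpleGraph V} {H : G.Subgraph} {k : ℕ}
    (φ : TotalColoring H.coe k) : Prop :=
  ∀ u v : H.verts, G.Adj u v → φ.vert u ≠ φ.vert v

/-- The total coloring `ψ` of `G` agrees with `φ` on all vertices and edges of the subgraph `H`. -/
def TotalColoring.Extends {V : Type*} {G : SimpleGraph V} {H : G.Subgraph} {k : ℕ}
    (ψ : TotalColoring G k) (φ : TotalColoring H.coe k) : Prop :=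
  (∀ v : H.verts, ψ.vert v = φ.vert v) ∧
    ∀ e : H.coe.edgeSet, ψ.edge (H.hom.mapEdgeSet e) = φ.edge e

/-!
A total coloring of `G` is a proper coloring of its total graph, and `φ` is one of a part of it,
so one can color greedily: first the remaining vertices, each of which has at most `Δ` neighbors
and `d` colored edges, then the remaining edges. Their ordering is built from its end: as a planar
graph is `5`-degenerate, among the remaining edges not placed yet there is an edge `vw` that
competes with at most `4` others of them at `v`. When it is colored, it sees its `2` ends, at most
`4 + d` edges at `v` and at most `Δ - 1` edges at `w`.

Degeneracy comes from `|E| < 3|V|` for planar graphs without pendant edges. Instead of Euler's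
formula and the Jordan curve theorem, this uses that the cycle space, of dimension at least
`|E| - |V| + 1`, embeds into the functions on the faces of a drawing: a cycle goes to its winding
numbers, which are constant on each face and jump by the weight of an edge across that edge.
Hence there are at least `|E| - |V| + 1` faces that touch an edge, whereas double counting gives
at most `2|E| / 3`, as every edge is touched by at most two of them and each touches at least
three edges.
-/

open Filter Topology Module

section Face

variable {X : Type*} [TopologicalSpace X] {S T U W : Set X}

/-- The faces of a set `S` are the connected components of its complement. -/
def IsFace (S U : Set X) : Prop :=
  ∃ x ∉ S, connectedComponentIn Sᶜ x = U

namespace IsFace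

theorem nonempty (hU : IsFace S U) : U.Nonempty := by
  obtain ⟨x, hx, rfl⟩ := hU
  exact ⟨x, mem_connectedComponentIn hx⟩

theorem isPreconnected (hU : IsFace S U) : IsPreconnected U := by
  obtain ⟨x, -, rfl⟩ := hU
  exact isPreconnected_connectedComponentIn

theorem subset_compl (hU : IsFace S U) : U ⊆ Sᶜ := by
  obtain ⟨x, -, rfl⟩ := hU
  exact connectedComponentIn_subset _ _

theorem isOpen [LocallyConnectedSpace X] (hS : IsClosed S) (hU : IsFace S U) : IsOpen U := by
  obtain ⟨x, -, rfl⟩ := hU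
  exact hS.isOpen_compl.connectedComponentIn

theorem subset_of_inter_nonempty (hU : IsFace S U) (hT : IsPreconnected T) (hTS : T ⊆ Sᶜ)
    (h : (T ∩ U).Nonempty) : T ⊆ U := by
  obtain ⟨x, -, rfl⟩ := hU
  obtain ⟨y, hyT, hyU⟩ := h
  rw [connectedComponentIn_eq hyU]
  exact hT.subset_connectedComponentIn hyT hTS

theorem eq_of_inter_nonempty (hU : IsFace S U) (hW : IsFace S W) (h : (U ∩ W).Nonempty) :
    U = W :=
  (hW.subset_of_inter_nonempty hU.isPreconnected hU.subset_compl h).antisymm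
    (hU.subset_of_inter_nonempty hW.isPreconnected hW.subset_compl (by rwa [Set.inter_comm]))

theorem closure_subset [LocallyConnectedSpace X] (hS : IsClosed S) (hU : IsFace S U) :
    closure U ⊆ U ∪ S := by
  intro x hx
  by_contra! hxU
  simp only [Set.mem_union, not_or] at hxU
  have hface : IsFace S (connectedComponentIn Sᶜ x) := ⟨x, hxU.2, rfl⟩
  have hxc := mem_connectedComponentIn (F := Sᶜ) hxU.2
  have hmeet := mem_closure_iff.1 hx _ (hface.isOpen hS) hxc
  exact hxU.1 (hface.eq_of_inter_nonempty hU hmeet ▸ hxc)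

end IsFace

theorem exists_isFace_superset (hT : IsPreconnected T) (hne : T.Nonempty) (hTS : T ⊆ Sᶜ) :
    ∃ U, IsFace S U ∧ T ⊆ U := by
  obtain ⟨x, hx⟩ := hne
  exact ⟨_, ⟨x, hTS hx, rfl⟩, hT.subset_connectedComponentIn hx hTS⟩

end Face

section Segment

variable {E : Type*} [AddCommGroup E] [Module ℝ E] {K : Type*}

/-- A family of nondegenerate segments `[a k, b k]`, any two of which meet only in common ends. -/
structure IsSegmentFamily (a b : K → E) : Prop where
  ne : ∀ k, a k ≠ b k
  eq_end : ∀ k l, k ≠ l → ∀ x ∈ segment ℝ (a k) (b k), x ∈ segment ℝ (a l) (b l) →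
    x = a k ∨ x = b k

/-- The union of a family of segments, that is, the set of points of a drawing. -/
def segmentUnion (a b : K → E) : Set E := ⋃ k, segment ℝ (a k) (b k)

/-- A set, usually a face of a drawing, touches a segment if some interior point of the segment
lies in its closure. -/
def Touches [TopologicalSpace E] (U : Set E) (a b : E) : Prop :=
  (closure U ∩ openSegment ℝ a b).Nonempty

theorem IsSegmentFamily.notMem_segment {a b : K → E} (h : IsSegmentFamily a b) {k l : K}
    (hlk : l ≠ k) {x : E} (hx : x ∈ openSegment ℝ (a k) (b k)) : x ∉ segment ℝ (a l) (b l) := by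
  intro hxl
  rcases h.eq_end k l hlk.symm x (openSegment_subset_segment ℝ _ _ hx) hxl with rfl | rfl
  · exact h.ne k (left_mem_openSegment_iff.1 hx)
  · exact h.ne k (right_mem_openSegment_iff.1 hx)

end Segment

section NormedSegment

variable {E : Type*} [NormedAddCommGroup E] [NormedSpace ℝ E] {K : Type*}

theorem isClosed_segment (a b : E) : IsClosed (segment ℝ a b) := by
  rw [← closure_openSegment]
  exact isClosed_closure

theorem isClosed_segmentUnion [Finite K] (a b : K → E) : IsClosed (segmentUnion a b) :=
  isClosed_iUnion_of_finite fun _ => isClosed_segment _ _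

theorem eventually_mem_segment_imp [Finite K] (a b : K → E) (q : E) :
    ∀ᶠ y in 𝓝 q, ∀ l, y ∈ segment ℝ (a l) (b l) →
      q ∈ segment ℝ (a l) (b l) ∧ (y = q ∨ y ∈ openSegment ℝ (a l) (b l)) := by
  have hne (c : E) : ∀ᶠ y in 𝓝 q, y = c → y = q := by
    rcases eq_or_ne q c with rfl | hqc
    · exact Eventually.of_forall fun _ => id
    · filter_upwards [isOpen_ne.mem_nhds hqc] with y hy h using absurd h hy
  have hmem (l : K) : ∀ᶠ y in 𝓝 q, y ∈ segment ℝ (a l) (b l) → q ∈ segment ℝ (a l) (b l) := by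
    by_cases hq : q ∈ segment ℝ (a l) (b l)
    · exact Eventually.of_forall fun _ _ => hq
    · filter_upwards [(isClosed_segment _ _).isOpen_compl.mem_nhds hq] with y hy h
        using absurd h hy
  refine eventually_all.2 fun l => ?_
  filter_upwards [hmem l, hne (a l), hne (b l)] with y hyq hya hyb hy
  refine ⟨hyq hy, or_iff_not_imp_left.2 fun hyne => ?_⟩
  exact mem_openSegment_of_ne_left_right (fun h => hyne (hya h.symm))
    (fun h => hyne (hyb h.symm)) hy

theorem starConvex_compl_ray {q v : E} (hv : v ≠ 0) {s : ℝ} (hs : 0 < s) :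
    StarConvex ℝ (q - s • v) {y | ∃ t : ℝ, 0 ≤ t ∧ y = q + t • v}ᶜ := by
  rintro y hy α β hα hβ hαβ ⟨t, ht, e⟩
  obtain rfl : α = 1 - β := by linarith
  have hβy : β • y = β • q + (t + (1 - β) * s) • v := by linear_combination (norm := module) e
  rcases hβ.eq_or_lt with rfl | hβ
  · have : (t + s) • v = 0 := by linear_combination (norm := module) -hβy
    exact smul_ne_zero (by positivity) hv this
  · refine hy ⟨(t + (1 - β) * s) / β, by positivity, smul_right_injective E hβ.ne' ?_⟩
    simp only [smul_add, smul_smul, mul_div_cancel₀ _ hβ.ne', hβy]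

theorem mem_segment_iff_of_mem_ball {q c y : E} {r : ℝ} (hrc : r ≤ dist c q)
    (hy : y ∈ Metric.ball q r) :
    y ∈ segment ℝ q c ↔ ∃ t : ℝ, 0 ≤ t ∧ y = q + t • (c - q) := by
  rw [segment_eq_image']
  refine ⟨fun ⟨t, ht, e⟩ => ⟨t, ht.1, e.symm⟩, ?_⟩
  rintro ⟨t, ht, rfl⟩
  refine ⟨t, ⟨ht, ?_⟩, rfl⟩
  rw [mem_ball_iff_norm, add_sub_cancel_left, norm_smul, Real.norm_of_nonneg ht,
    ← dist_eq_norm] at hy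
  by_contra! hlt
  nlinarith [dist_nonneg (x := c) (y := q)]

theorem isPreconnected_ball_diff_segment {q c : E} {r : ℝ} (hcq : c ≠ q) (hrc : r ≤ dist c q) :
    IsPreconnected (Metric.ball q r \ segment ℝ q c) := by
  rcases le_or_gt r 0 with hr | hr
  · simp only [Metric.ball_eq_empty.2 hr, Set.empty_sdiff, isPreconnected_empty]
  have hv : c - q ≠ 0 := sub_ne_zero.2 hcq
  set s : ℝ := r / (2 * ‖c - q‖) with hs
  have hs0 : 0 < s := by positivity
  have hball : q - s • (c - q) ∈ Metric.ball q r := by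
    rw [mem_ball_iff_norm, sub_sub_cancel_left, norm_neg, norm_smul, Real.norm_of_nonneg hs0.le, hs]
    field_simp
    linarith
  have hray : Metric.ball q r \ segment ℝ q c =
      Metric.ball q r ∩ {y | ∃ t : ℝ, 0 ≤ t ∧ y = q + t • (c - q)}ᶜ := by
    ext y
    exact and_congr_right fun hy => not_congr (mem_segment_iff_of_mem_ball hrc hy)
  have hstar := ((convex_ball q r).starConvex hball).inter (starConvex_compl_ray (q := q) hv hs0)
  rw [hray]
  rcases Set.eq_empty_or_nonempty
    (Metric.ball q r ∩ {y | ∃ t : ℝ, 0 ≤ t ∧ y = q + t • (c - q)}ᶜ) with he | hne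
  · simp only [he, isPreconnected_empty]
  · exact (hstar.isPathConnected (hstar.mem hne)).isConnected.isPreconnected

theorem isPreconnected_ball_diff_segment_of_end {a b q : E} {r : ℝ} (hab : a ≠ b)
    (hq : q = a ∨ q = b) (hr : r ≤ dist a b) :
    IsPreconnected (Metric.ball q r \ segment ℝ a b) := by
  rcases hq with rfl | rfl
  · exact isPreconnected_ball_diff_segment hab.symm (by rwa [dist_comm])
  · rw [segment_symm]
    exact isPreconnected_ball_diff_segment hab hr

/-- Otherwise `U` would contain a whole ball about `q` except for the segment `k`, and hence points
of the segment `l₀`. -/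
theorem IsSegmentFamily.exists_touches_of_end [Finite K] {a b : K → E} (h : IsSegmentFamily a b)
    {k l₀ : K} {q : E} {U : Set E} (hq : q = a k ∨ q = b k) (hU : IsFace (segmentUnion a b) U)
    (hqU : q ∈ closure U) (hl₀ : l₀ ≠ k) (hql₀ : q ∈ segment ℝ (a l₀) (b l₀)) :
    ∃ l ≠ k, q ∈ segment ℝ (a l) (b l) ∧ Touches U (a l) (b l) := by
  have hqk : q ∈ segment ℝ (a k) (b k) := by
    rcases hq with rfl | rfl
    exacts [left_mem_segment ℝ _ _, right_mem_segment ℝ _ _]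
  obtain ⟨R, hR, hnear⟩ := Metric.eventually_nhds_iff_ball.1 (eventually_mem_segment_imp a b q)
  set r := min R (dist (a k) (b k))
  have hr : 0 < r := lt_min hR (dist_pos.2 (h.ne k))
  by_contra! hno
  have hclosure : closure U ∩ (Metric.ball q r \ segment ℝ (a k) (b k)) ⊆ U := by
    rintro y ⟨hyU, hyr, hyk⟩
    refine (hU.closure_subset (isClosed_segmentUnion a b) hyU).resolve_right fun hy => ?_
    obtain ⟨l, hl⟩ := Set.mem_iUnion.1 hy
    have hlk : l ≠ k := fun hlk => hyk (hlk ▸ hl)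
    obtain ⟨hql, rfl | hyo⟩ := hnear y (Metric.ball_subset_ball (min_le_left _ _) hyr) l hl
    · exact hyk hqk
    · exact hno l hlk hql ⟨y, hyU, hyo⟩
  have hmeet : ((Metric.ball q r \ segment ℝ (a k) (b k)) ∩ U).Nonempty := by
    obtain ⟨y, hyr, hyU⟩ := mem_closure_iff_nhds.1 hqU _ (Metric.ball_mem_nhds q hr)
    exact ⟨y, ⟨hyr, fun hyk => hU.subset_compl hyU (Set.mem_iUnion.2 ⟨k, hyk⟩)⟩, hyU⟩
  have hconn := isPreconnected_ball_diff_segment_of_end (h.ne k) hq (min_le_right R _)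
  have hsub : Metric.ball q r \ segment ℝ (a k) (b k) ⊆ U :=
    hconn.subset_of_closure_inter_subset (hU.isOpen (isClosed_segmentUnion a b)) hmeet hclosure
  have hqo : q ∈ closure (openSegment ℝ (a l₀) (b l₀)) := by rwa [closure_openSegment]
  obtain ⟨y, hyr, hyo⟩ := mem_closure_iff_nhds.1 hqo _ (Metric.ball_mem_nhds q hr)
  exact hU.subset_compl (hsub ⟨hyr, h.notMem_segment hl₀.symm hyo⟩)
    (Set.mem_iUnion.2 ⟨l₀, openSegment_subset_segment ℝ _ _ hyo⟩)

end NormedSegment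

section Side

variable {a b x y : ℂ} {r : ℝ}

/-- The signed distance of `y` from the line through `a` and `b`, in units of the length of
`b - a`; it is positive on the left of the line. -/
noncomputable def sideOf (a b y : ℂ) : ℝ := ((y - a) / (b - a)).im

/-- The open half plane to the left of the line from `a` to `b`. -/
def leftSide (a b : ℂ) : Set ℂ := {y | 0 < sideOf a b y}

theorem mem_leftSide : y ∈ leftSide a b ↔ 0 < sideOf a b y := Iff.rfl

/-- The part of a ball to the left of the line from `a` to `b`. -/
def halfBall (a b x : ℂ) (r : ℝ) : Set ℂ := Metric.ball x r ∩ leftSide a b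

theorem sideOf_eq_zero (hy : y ∈ segment ℝ a b) : sideOf a b y = 0 := by
  rw [segment_eq_image'] at hy
  obtain ⟨t, -, rfl⟩ := hy
  rw [sideOf, add_sub_cancel_left, Complex.real_smul, mul_div_assoc, Complex.im_ofReal_mul]
  rcases eq_or_ne (b - a) 0 with h | h <;> simp [h]

theorem sideOf_swap (hab : a ≠ b) (y : ℂ) : sideOf b a y = -sideOf a b y := by
  have hba : b - a ≠ 0 := sub_ne_zero.2 hab.symm
  have h : (y - b) / (a - b) = 1 - (y - a) / (b - a) := by
    rw [← neg_sub b a]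
    field_simp
    ring
  simp [sideOf, h]

theorem sideOf_add (hab : a ≠ b) (y : ℂ) (t : ℝ) :
    sideOf a b (y + t * (Complex.I * (b - a))) = sideOf a b y + t := by
  have hba : b - a ≠ 0 := sub_ne_zero.2 hab.symm
  have h : (y + t * (Complex.I * (b - a)) - a) / (b - a) = (y - a) / (b - a) + t * Complex.I := by
    field_simp
    ring
  simp [sideOf, h]

theorem convex_leftSide (a b : ℂ) : Convex ℝ (leftSide a b) := by
  have hlin : IsLinearMap ℝ fun y : ℂ => (y / (b - a)).im :=
    ⟨fun y z => by simp [add_div], fun t y => by simp [mul_div_assoc]⟩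
  simpa only [leftSide, sideOf, sub_div, Complex.sub_im, sub_pos] using
    convex_halfSpace_gt hlin (a / (b - a)).im

theorem isPreconnected_halfBall (a b x : ℂ) (r : ℝ) : IsPreconnected (halfBall a b x r) :=
  ((convex_ball x r).inter (convex_leftSide a b)).isPreconnected

theorem mem_closure_leftSide (hab : a ≠ b) (h0 : sideOf a b y = 0) :
    y ∈ closure (leftSide a b) := by
  have hcont : Continuous fun t : ℝ => y + t * (Complex.I * (b - a)) := by fun_prop
  have hlim : Tendsto (fun t : ℝ => y + t * (Complex.I * (b - a))) (𝓝[>] 0) (𝓝 y) := by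
    simpa using (hcont.tendsto 0).mono_left nhdsWithin_le_nhds
  refine mem_closure_of_tendsto hlim ?_
  filter_upwards [self_mem_nhdsWithin] with t ht
  rwa [mem_leftSide, sideOf_add hab, h0, zero_add]

theorem mem_closure_halfBall (hab : a ≠ b) (hy : y ∈ Metric.ball x r) (h0 : sideOf a b y = 0) :
    y ∈ closure (halfBall a b x r) :=
  Metric.isOpen_ball.inter_closure ⟨hy, mem_closure_leftSide hab h0⟩

theorem halfBall_nonempty (hab : a ≠ b) (hr : 0 < r) (h0 : sideOf a b x = 0) :
    (halfBall a b x r).Nonempty :=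
  closure_nonempty_iff.1 ⟨x, mem_closure_halfBall hab (Metric.mem_ball_self hr) h0⟩

end Side

namespace IsSegmentFamily

variable {K : Type*} [Finite K] {a b : K → ℂ} {k : K} {x : ℂ} {U : Set ℂ}

theorem exists_halfBall_subset_compl (h : IsSegmentFamily a b)
    (hx : x ∈ openSegment ℝ (a k) (b k)) :
    ∃ r > 0, halfBall (a k) (b k) x r ⊆ (segmentUnion a b)ᶜ ∧
      halfBall (b k) (a k) x r ⊆ (segmentUnion a b)ᶜ := by
  obtain ⟨r, hr, hnear⟩ := Metric.eventually_nhds_iff_ball.1 (eventually_mem_segment_imp a b x)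
  have hzero : ∀ y ∈ Metric.ball x r, y ∈ segmentUnion a b → sideOf (a k) (b k) y = 0 := by
    intro y hy hyS
    obtain ⟨l, hl⟩ := Set.mem_iUnion.1 hyS
    obtain rfl : l = k := by
      by_contra hlk
      exact h.notMem_segment hlk hx (hnear y hy l hl).1
    exact sideOf_eq_zero hl
  refine ⟨r, hr, fun y hy hyS => (mem_leftSide.1 hy.2).ne' (hzero y hy.1 hyS),
    fun y hy hyS => (mem_leftSide.1 hy.2).ne' ?_⟩
  rw [sideOf_swap (h.ne k), hzero y hy.1 hyS, neg_zero]

theorem halfBall_subset_or_halfBall_subset (h : IsSegmentFamily a b) {r : ℝ} (hr : 0 < r)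
    (hleft : halfBall (a k) (b k) x r ⊆ (segmentUnion a b)ᶜ)
    (hright : halfBall (b k) (a k) x r ⊆ (segmentUnion a b)ᶜ)
    (hU : IsFace (segmentUnion a b) U) (hxU : x ∈ closure U) :
    halfBall (a k) (b k) x r ⊆ U ∨ halfBall (b k) (a k) x r ⊆ U := by
  have hopen : IsOpen (U ∩ Metric.ball x r) :=
    (hU.isOpen (isClosed_segmentUnion a b)).inter Metric.isOpen_ball
  obtain ⟨y, ⟨hyU, hyr⟩, hy⟩ : ∃ y ∈ U ∩ Metric.ball x r, sideOf (a k) (b k) y ≠ 0 := by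
    obtain ⟨y, hyr, hyU⟩ := mem_closure_iff_nhds.1 hxU _ (Metric.ball_mem_nhds x hr)
    by_cases hy : sideOf (a k) (b k) y = 0
    · obtain ⟨z, hz, hz'⟩ :=
        mem_closure_iff.1 (mem_closure_leftSide (h.ne k) hy) _ hopen ⟨hyU, hyr⟩
      exact ⟨z, hz, hz'.ne'⟩
    · exact ⟨y, ⟨hyU, hyr⟩, hy⟩
  rcases hy.lt_or_gt with hlt | hgt
  · refine Or.inr (hU.subset_of_inter_nonempty (isPreconnected_halfBall _ _ _ _) hright
      ⟨y, ⟨hyr, ?_⟩, hyU⟩)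
    rwa [mem_leftSide, sideOf_swap (h.ne k), neg_pos]
  · exact Or.inl (hU.subset_of_inter_nonempty (isPreconnected_halfBall _ _ _ _) hleft
      ⟨y, ⟨hyr, hgt⟩, hyU⟩)

theorem eventually_mem_closure (h : IsSegmentFamily a b) (hx : x ∈ openSegment ℝ (a k) (b k))
    (hU : IsFace (segmentUnion a b) U) (hxU : x ∈ closure U) :
    ∀ᶠ y in 𝓝 x, y ∈ openSegment ℝ (a k) (b k) → y ∈ closure U := by
  obtain ⟨r, hr, hleft, hright⟩ := h.exists_halfBall_subset_compl hx
  filter_upwards [Metric.ball_mem_nhds x hr] with y hyr hy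
  have hy0 := sideOf_eq_zero (openSegment_subset_segment ℝ _ _ hy)
  rcases h.halfBall_subset_or_halfBall_subset hr hleft hright hU hxU with hs | hs
  · exact closure_mono hs (mem_closure_halfBall (h.ne k) hyr hy0)
  · exact closure_mono hs (mem_closure_halfBall (h.ne k).symm hyr
      (by rw [sideOf_swap (h.ne k), hy0, neg_zero]))

theorem openSegment_subset_closure (h : IsSegmentFamily a b) (hU : IsFace (segmentUnion a b) U)
    (ht : Touches U (a k) (b k)) : openSegment ℝ (a k) (b k) ⊆ closure U := by
  obtain ⟨x, hxU, hx⟩ := ht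
  intro y hy
  refine ((convex_openSegment (𝕜 := ℝ) (a k) (b k)).isPreconnected.induction₂
    (fun x y => x ∈ closure U ↔ y ∈ closure U) (fun x hx => ?_)
    (fun _ _ _ _ _ _ => Iff.trans) (fun _ _ _ _ => Iff.symm) hx hy).1 hxU
  by_cases hxU : x ∈ closure U
  · filter_upwards [mem_nhdsWithin_of_mem_nhds (h.eventually_mem_closure hx hU hxU),
      self_mem_nhdsWithin] with y hy hyk using iff_of_true hxU (hy hyk)
  · filter_upwards [mem_nhdsWithin_of_mem_nhds (isClosed_closure.isOpen_compl.mem_nhds hxU)]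
      with y hy using iff_of_false hxU hy

theorem segment_subset_closure (h : IsSegmentFamily a b) (hU : IsFace (segmentUnion a b) U)
    (ht : Touches U (a k) (b k)) : segment ℝ (a k) (b k) ⊆ closure U := by
  rw [← closure_openSegment]
  exact closure_minimal (h.openSegment_subset_closure hU ht) isClosed_closure

theorem exists_two_faces (h : IsSegmentFamily a b) (k : K) :
    ∃ U₁ U₂, ∀ U, IsFace (segmentUnion a b) U → Touches U (a k) (b k) → U = U₁ ∨ U = U₂ := by
  have hm := midpoint_mem_openSegment (𝕜 := ℝ) (a k) (b k)
  obtain ⟨r, hr, hleft, hright⟩ := h.exists_halfBall_subset_compl hm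
  have h0 := sideOf_eq_zero (openSegment_subset_segment ℝ _ _ hm)
  have hleft_ne := halfBall_nonempty (h.ne k) hr h0
  have hright_ne := halfBall_nonempty (h.ne k).symm hr (by rw [sideOf_swap (h.ne k), h0, neg_zero])
  obtain ⟨U₁, hU₁, h₁⟩ := exists_isFace_superset (isPreconnected_halfBall _ _ _ _) hleft_ne hleft
  obtain ⟨U₂, hU₂, h₂⟩ := exists_isFace_superset (isPreconnected_halfBall _ _ _ _) hright_ne hright
  refine ⟨U₁, U₂, fun U hU ht => ?_⟩
  have hmU := h.openSegment_subset_closure hU ht hm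
  refine (h.halfBall_subset_or_halfBall_subset hr hleft hright hU hmU).imp (fun hs => ?_)
    fun hs => ?_
  · exact hU.eq_of_inter_nonempty hU₁ (hleft_ne.mono (Set.subset_inter hs h₁))
  · exact hU.eq_of_inter_nonempty hU₂ (hright_ne.mono (Set.subset_inter hs h₂))

end IsSegmentFamily

section LogQuotient

variable {a b p x : ℂ}

theorem mem_slitPlane_of_notMem_segment (h : p ∉ segment ℝ a b) :
    (b - p) / (a - p) ∈ Complex.slitPlane := by
  have ha : a - p ≠ 0 := sub_ne_zero.2 fun e => h (e ▸ left_mem_segment ℝ a b)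
  by_contra hn
  rw [Complex.mem_slitPlane_iff, not_or, not_lt, not_not] at hn
  obtain ⟨c, hc, hcp⟩ : ∃ c : ℝ, 0 ≤ c ∧ (b - p) / (a - p) = -(c : ℂ) :=
    ⟨-((b - p) / (a - p)).re, neg_nonneg.2 hn.1, by apply Complex.ext <;> simp [hn.2]⟩
  rw [div_eq_iff ha] at hcp
  have hc1 : (1 + c : ℂ) ≠ 0 := by exact_mod_cast (by positivity : (1 + c : ℝ) ≠ 0)
  refine h ⟨c / (1 + c), 1 / (1 + c), by positivity, by positivity, by field_simp; ring, ?_⟩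
  simp only [Complex.real_smul, Complex.ofReal_div, Complex.ofReal_add, Complex.ofReal_one]
  field_simp
  linear_combination hcp

theorem hasDerivAt_log_sub_div_sub (h : p ∉ segment ℝ a b) :
    HasDerivAt (fun p => Complex.log ((b - p) / (a - p))) ((a - p)⁻¹ - (b - p)⁻¹) p := by
  have ha : a - p ≠ 0 := sub_ne_zero.2 fun e => h (e ▸ left_mem_segment ℝ a b)
  have hb : b - p ≠ 0 := sub_ne_zero.2 fun e => h (e ▸ right_mem_segment ℝ a b)
  refine ((((hasDerivAt_id p).const_sub b).div ((hasDerivAt_id p).const_sub a) ha).clog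
    (mem_slitPlane_of_notMem_segment h)).congr_deriv ?_
  simp only [id, Pi.div_apply]
  field_simp
  ring

theorem im_sub_div_sub (hab : a ≠ b) (p : ℂ) :
    ((b - p) / (a - p)).im = sideOf a b p / Complex.normSq ((p - a) / (b - a)) := by
  rcases eq_or_ne p a with rfl | hpa
  · simp
  have hpa : p - a ≠ 0 := sub_ne_zero.2 hpa
  have h : (b - p) / (a - p) = 1 - ((p - a) / (b - a))⁻¹ := by
    rw [← neg_sub p a, inv_div]
    field_simp
    ring
  rw [h, Complex.sub_im, Complex.one_im, Complex.inv_im, sideOf]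
  ring

theorem exists_neg_eq_sub_div_sub (hab : a ≠ b) (hx : x ∈ openSegment ℝ a b) :
    ∃ c : ℝ, c < 0 ∧ (b - x) / (a - x) = c := by
  rw [openSegment_eq_image'] at hx
  obtain ⟨t, ⟨ht0, ht1⟩, rfl⟩ := hx
  have hba : b - a ≠ 0 := sub_ne_zero.2 hab.symm
  refine ⟨-((1 - t) / t), neg_lt_zero.2 (div_pos (sub_pos.2 ht1) ht0), ?_⟩
  have ht : (t : ℂ) ≠ 0 := Complex.ofReal_ne_zero.2 ht0.ne'
  simp only [sub_add_cancel_left, Complex.real_smul]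
  push_cast
  field_simp
  ring

theorem continuousAt_sub_div_sub (hab : a ≠ b) (hx : x ∈ openSegment ℝ a b) :
    ContinuousAt (fun p => (b - p) / (a - p)) x := by
  have hxa : a - x ≠ 0 := by
    refine sub_ne_zero.2 ?_
    rintro rfl
    exact hab (left_mem_openSegment_iff.1 hx)
  fun_prop (disch := assumption)

theorem tendsto_log_leftSide (hab : a ≠ b) (hx : x ∈ openSegment ℝ a b) :
    Tendsto (fun p => Complex.log ((b - p) / (a - p))) (𝓝[leftSide a b] x)
      (𝓝 (Real.log ‖(b - x) / (a - x)‖ + Real.pi * Complex.I)) := by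
  obtain ⟨c, hc, hcx⟩ := exists_neg_eq_sub_div_sub hab hx
  refine (Complex.tendsto_log_nhdsWithin_im_nonneg_of_re_neg_of_im_zero (by simpa [hcx])
    (by simp [hcx])).comp (tendsto_nhdsWithin_iff.2
      ⟨(continuousAt_sub_div_sub hab hx).mono_left nhdsWithin_le_nhds, ?_⟩)
  filter_upwards [self_mem_nhdsWithin] with p hp
  exact (im_sub_div_sub hab p).symm ▸ div_nonneg (mem_leftSide.1 hp).le (Complex.normSq_nonneg _)

theorem tendsto_log_rightSide (hab : a ≠ b) (hx : x ∈ openSegment ℝ a b) :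
    Tendsto (fun p => Complex.log ((b - p) / (a - p))) (𝓝[leftSide b a] x)
      (𝓝 (Real.log ‖(b - x) / (a - x)‖ - Real.pi * Complex.I)) := by
  obtain ⟨c, hc, hcx⟩ := exists_neg_eq_sub_div_sub hab hx
  refine (Complex.tendsto_log_nhdsWithin_im_neg_of_re_neg_of_im_zero (by simpa [hcx])
    (by simp [hcx])).comp (tendsto_nhdsWithin_iff.2
      ⟨(continuousAt_sub_div_sub hab hx).mono_left nhdsWithin_le_nhds, ?_⟩)
  filter_upwards [self_mem_nhdsWithin] with p hp
  have hside : sideOf a b p < 0 := by rwa [mem_leftSide, sideOf_swap hab, neg_pos] at hp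
  exact (im_sub_div_sub hab p).symm ▸ div_neg_of_neg_of_pos hside
    (Complex.normSq_pos.2 fun h => hside.ne (by rw [sideOf, h, Complex.zero_im]))

end LogQuotient

section Winding

variable {K : Type*} [Fintype K] {a b : K → ℂ} {U : Set ℂ} {z : K → ℂ}

/-- The weights `z` on the segments `[a k, b k]` form a cycle, that is, have zero boundary. The
boundary is tested against arbitrary functions on the plane. -/
def IsCycle (a b z : K → ℂ) : Prop := ∀ f : ℂ → ℂ, ∑ k, z k * (f (a k) - f (b k)) = 0

/-- The winding number about `p`, up to the factor `2πi`, of a weighted family of segments. -/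
noncomputable def winding (a b : K → ℂ) (p : ℂ) : (K → ℂ) →ₗ[ℂ] ℂ :=
  Fintype.linearCombination ℂ fun k => Complex.log ((b k - p) / (a k - p))

theorem IsFace.winding_eq (hU : IsFace (segmentUnion a b) U) (hz : IsCycle a b z) {x y : ℂ}
    (hx : x ∈ U) (hy : y ∈ U) : winding a b x z = winding a b y z := by
  have hderiv : ∀ p ∈ U, HasDerivAt (fun p => winding a b p z) 0 p := by
    intro p hp
    have h := HasDerivAt.fun_sum (u := Finset.univ) fun k _ => (hasDerivAt_log_sub_div_sub
      fun hk => hU.subset_compl hp (Set.mem_iUnion.2 ⟨k, hk⟩)).const_mul (z k)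
    rwa [hz fun q => (q - p)⁻¹] at h
  exact (hU.isOpen (isClosed_segmentUnion a b)).is_const_of_deriv_eq_zero hU.isPreconnected
    (fun p hp => (hderiv p hp).differentiableAt.differentiableWithinAt)
    (fun p hp => (hderiv p hp).deriv) hx hy

namespace IsSegmentFamily

theorem exists_tendsto_winding (h : IsSegmentFamily a b) (z : K → ℂ) {k : K} {x : ℂ}
    (hx : x ∈ openSegment ℝ (a k) (b k)) :
    ∃ c, Tendsto (winding a b · z) (𝓝[leftSide (a k) (b k)] x)
        (𝓝 (c + z k * (Real.pi * Complex.I))) ∧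
      Tendsto (winding a b · z) (𝓝[leftSide (b k) (a k)] x)
        (𝓝 (c - z k * (Real.pi * Complex.I))) := by
  classical
  set rest : ℂ → ℂ := fun p =>
    ∑ l ∈ Finset.univ.erase k, z l * Complex.log ((b l - p) / (a l - p))
  have hcont : ContinuousAt rest x := tendsto_finsetSum _ fun l hl =>
    (hasDerivAt_log_sub_div_sub
      (h.notMem_segment (Finset.ne_of_mem_erase hl) hx)).continuousAt.const_mul (z l)
  have hsplit : (winding a b · z) =
      fun p => rest p + z k * Complex.log ((b k - p) / (a k - p)) := by
    funext p
    exact (Finset.sum_erase_add _ _ (Finset.mem_univ k)).symm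
  refine ⟨rest x + z k * Real.log ‖(b k - x) / (a k - x)‖, ?_, ?_⟩ <;> rw [hsplit]
  · rw [add_assoc, ← mul_add]
    exact (hcont.mono_left nhdsWithin_le_nhds).add ((tendsto_log_leftSide (h.ne k) hx).const_mul _)
  · rw [add_sub_assoc, ← mul_sub]
    exact (hcont.mono_left nhdsWithin_le_nhds).add ((tendsto_log_rightSide (h.ne k) hx).const_mul _)

theorem eq_zero_of_winding_eq_zero (h : IsSegmentFamily a b) {k : K}
    (h0 : ∀ U, IsFace (segmentUnion a b) U → Touches U (a k) (b k) →
      ∀ p ∈ U, winding a b p z = 0) : z k = 0 := by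
  have hm := midpoint_mem_openSegment (𝕜 := ℝ) (a k) (b k)
  set m := midpoint ℝ (a k) (b k)
  obtain ⟨r, hr, hleft, hright⟩ := h.exists_halfBall_subset_compl hm
  obtain ⟨c, hcleft, hcright⟩ := h.exists_tendsto_winding z hm
  have hm0 := sideOf_eq_zero (openSegment_subset_segment ℝ _ _ hm)
  have hm0' : sideOf (b k) (a k) m = 0 := by rw [sideOf_swap (h.ne k), hm0, neg_zero]
  have hlim {s t w : ℂ} (hst : s ≠ t) (hs0 : sideOf s t m = 0)
      (hs : halfBall s t m r ⊆ (segmentUnion a b)ᶜ)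
      (hw : Tendsto (winding a b · z) (𝓝[leftSide s t] m) (𝓝 w)) : w = 0 := by
    obtain ⟨U, hU, hsU⟩ := exists_isFace_superset (isPreconnected_halfBall _ _ _ _)
      (halfBall_nonempty hst hr hs0) hs
    have hmU := closure_mono hsU (mem_closure_halfBall hst (Metric.mem_ball_self hr) hs0)
    have : (𝓝[leftSide s t] m).NeBot :=
      mem_closure_iff_nhdsWithin_neBot.1 (mem_closure_leftSide hst hs0)
    refine tendsto_nhds_unique hw (tendsto_const_nhds.congr' ?_)
    filter_upwards [inter_mem_nhdsWithin _ (Metric.ball_mem_nhds m hr)] with p hp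
    exact (h0 U hU ⟨m, hmU, hm⟩ p (hsU ⟨hp.2, hp.1⟩)).symm
  have hplus := hlim (h.ne k) hm0 hleft hcleft
  have hminus := hlim (h.ne k).symm hm0' hright hcright
  have hjump : z k * (Real.pi * Complex.I) = 0 := by linear_combination (hplus - hminus) / 2
  exact (mul_eq_zero.1 hjump).resolve_right
    (mul_ne_zero (Complex.ofReal_ne_zero.2 Real.pi_ne_zero) Complex.I_ne_zero)

end IsSegmentFamily

end Winding

theorem le_add_length_of_length_eq_dist {V : Type*} {G : SimpleGraph V} {u v : V} {p : G.Walk u v}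
    (hp : p.length = G.dist u v) {i j : ℕ} (hj : j ≤ p.length)
    (q : G.Walk (p.getVert i) (p.getVert j)) : j ≤ i + q.length := by
  have h := G.dist_le (((p.take i).append q).append (p.drop j))
  simp only [SimpleGraph.Walk.length_append, SimpleGraph.Walk.take_length,
    SimpleGraph.Walk.drop_length] at h
  lia

section Chain

variable {E : Type*} [AddCommGroup E] [Module ℝ E] {n : ℕ} {p : ℕ → E} {S : Set E}

/-- The polygonal curve with corners `p 0, …, p n` does not degenerate or meet itself: two of its
segments meet only if they are consecutive, and then only in their common corner. -/
structure IsSimpleChain (n : ℕ) (p : ℕ → E) : Prop where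
  ne : ∀ i < n, p i ≠ p (i + 1)
  eq_succ : ∀ i j, i < j → j < n → ∀ x ∈ segment ℝ (p i) (p (i + 1)),
    x ∈ segment ℝ (p j) (p (j + 1)) → j = i + 1 ∧ x = p (i + 1)

namespace IsSimpleChain

theorem eq_zero_of_start_mem (h : IsSimpleChain n p) {i : ℕ} (hi : i < n)
    (hm : p 0 ∈ segment ℝ (p i) (p (i + 1))) : i = 0 := by
  by_contra h0
  exact h.ne 0 (by lia) (h.eq_succ 0 i (by lia) hi _ (left_mem_segment ℝ _ _) hm).2

theorem succ_eq_of_finish_mem (h : IsSimpleChain n p) {i : ℕ} (hi : i < n)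
    (hm : p n ∈ segment ℝ (p i) (p (i + 1))) : i + 1 = n := by
  obtain ⟨m, rfl⟩ : ∃ m, n = m + 1 := ⟨n - 1, by lia⟩
  by_contra hne
  obtain ⟨rfl, h2⟩ := h.eq_succ i m (by lia) (by lia) _ hm (right_mem_segment ℝ _ _)
  exact h.ne (i + 1) (by lia) h2.symm

theorem eq_or_eq_succ_of_corner_mem (h : IsSimpleChain n p) {i j : ℕ} (hi : i < n) (hj : j < n)
    (hm : p (i + 1) ∈ segment ℝ (p j) (p (j + 1))) : j = i ∨ j = i + 1 := by
  rcases lt_trichotomy j i with hji | rfl | hij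
  · obtain ⟨rfl, h2⟩ := h.eq_succ j i hji hi _ hm (right_mem_segment ℝ _ _)
    exact absurd h2.symm (h.ne (j + 1) hi)
  · exact Or.inl rfl
  · exact Or.inr (h.eq_succ i j hij hj _ (right_mem_segment ℝ _ _) hm).1

end IsSimpleChain

/-- Two points are adjacent if they see each other within `S`. Polygonal curves in `S` are the
walks in this graph, and simple ones are found among its shortest walks. -/
def visibilityGraph (S : Set E) : SimpleGraph E where
  Adj x y := x ≠ y ∧ segment ℝ x y ⊆ S
  symm := ⟨fun x y h => ⟨h.1.symm, by rw [segment_symm]; exact h.2⟩⟩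
  loopless := ⟨fun _ h => h.1 rfl⟩

theorem exists_walk_length_le_one {x y : E} (h : segment ℝ x y ⊆ S) :
    ∃ q : (visibilityGraph S).Walk x y, q.length ≤ 1 := by
  rcases eq_or_ne x y with rfl | hxy
  · exact ⟨.nil, zero_le_one⟩
  · exact ⟨.cons ⟨hxy, h⟩ .nil, le_rfl⟩

theorem visibilityGraph_reachable (h : ∀ i < n, segment ℝ (p i) (p (i + 1)) ⊆ S) :
    (visibilityGraph S).Reachable (p 0) (p n) := by
  induction n with
  | zero => exact .refl _
  | succ n ih =>
    obtain ⟨q, -⟩ := exists_walk_length_le_one (h n n.lt_succ_self)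
    exact (ih fun i hi => h i (by lia)).trans ⟨q⟩

theorem segment_subset_or_segment_subset_of_mem {a b c w : E} (hw : w ≠ b)
    (hab : w ∈ segment ℝ a b) (hbc : w ∈ segment ℝ b c) :
    segment ℝ a c ⊆ segment ℝ a b ∨ segment ℝ a c ⊆ segment ℝ b c := by
  rw [segment_symm, mem_segment_iff_wbtw] at hab
  rw [mem_segment_iff_wbtw] at hbc
  have hray : SameRay ℝ (a -ᵥ b) (c -ᵥ b) :=
    hab.sameRay_vsub_left.symm.trans hbc.sameRay_vsub_left fun h0 =>
      absurd (vsub_eq_zero_iff_eq.1 h0) hw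
  rcases wbtw_total_of_sameRay_vsub_left hray with h | h
  · exact Or.inr ((convex_segment _ _).segment_subset (mem_segment_iff_wbtw.2 h)
      (right_mem_segment ℝ _ _))
  · refine Or.inl ((convex_segment _ _).segment_subset (left_mem_segment ℝ _ _) ?_)
    rw [segment_symm]
    exact mem_segment_iff_wbtw.2 h

theorem isSimpleChain_of_length_eq_dist {x y : E} {q : (visibilityGraph S).Walk x y}
    (hq : q.length = (visibilityGraph S).dist x y) : IsSimpleChain q.length q.getVert := by
  have hS : ∀ i < q.length, segment ℝ (q.getVert i) (q.getVert (i + 1)) ⊆ S := fun i hi =>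
    (q.adj_getVert_succ hi).2
  refine ⟨fun i hi => (q.adj_getVert_succ hi).1, fun i j hij hj w hwi hwj => ?_⟩
  obtain rfl : j = i + 1 := by
    obtain ⟨q₁, hq₁⟩ := exists_walk_length_le_one
      (((convex_segment _ _).segment_subset (left_mem_segment ℝ _ _) hwi).trans (hS i (by lia)))
    obtain ⟨q₂, hq₂⟩ := exists_walk_length_le_one
      (((convex_segment _ _).segment_subset hwj (right_mem_segment ℝ _ _)).trans (hS j hj))
    have := le_add_length_of_length_eq_dist hq hj (q₁.append q₂)
    rw [SimpleGraph.Walk.length_append] at this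
    lia
  refine ⟨rfl, by_contra fun hw => ?_⟩
  have hshort : segment ℝ (q.getVert i) (q.getVert (i + 1 + 1)) ⊆ S :=
    (segment_subset_or_segment_subset_of_mem hw hwi hwj).elim
      (fun h => h.trans (hS i (by lia))) fun h => h.trans (hS (i + 1) hj)
  obtain ⟨q', hq'⟩ := exists_walk_length_le_one hshort
  have := le_add_length_of_length_eq_dist hq hj q'
  lia

theorem exists_isSimpleChain (h : ∀ i < n, segment ℝ (p i) (p (i + 1)) ⊆ S) :
    ∃ (m : ℕ) (q : ℕ → E), q 0 = p 0 ∧ q m = p n ∧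
      (∀ i < m, segment ℝ (q i) (q (i + 1)) ⊆ S) ∧ IsSimpleChain m q := by
  obtain ⟨q, hq⟩ := (visibilityGraph_reachable h).exists_walk_length_eq_dist
  exact ⟨q.length, q.getVert, q.getVert_zero, q.getVert_length,
    fun i hi => (q.adj_getVert_succ hi).2, isSimpleChain_of_length_eq_dist hq⟩

end Chain

theorem IsPolygonalCurve.exists_isSimpleChain {E : Type*} [AddCommGroup E] [Module ℝ E]
    {x y : Plane} {S : Set Plane} (h : IsPolygonalCurve x y S) (φ : Plane →ₗ[ℝ] E) :
    ∃ (n : ℕ) (p : ℕ → E), p 0 = φ x ∧ p n = φ y ∧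
      (∀ i < n, segment ℝ (p i) (p (i + 1)) ⊆ φ '' S) ∧ IsSimpleChain n p := by
  obtain ⟨n, p, rfl, rfl, rfl⟩ := h
  refine _root_.exists_isSimpleChain (p := φ ∘ p) fun i hi => ?_
  rw [Function.comp_apply, Function.comp_apply, ← LinearMap.coe_toAffineMap, ← image_segment]
  exact Set.image_mono (Set.subset_biUnion_of_mem (u := fun i => segment ℝ (p i) (p (i + 1))) hi)

/-- A drawing of `G` in the complex plane without crossings, in which the edge `e`, directed from
`tail e` to `head e`, is the simple polygonal curve with corners
`corner e 0, …, corner e (length e)`. -/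
structure SimpleDrawing {V : Type*} (G : SimpleGraph V) where
  point : V → ℂ
  tail : G.edgeSet → V
  head : G.edgeSet → V
  length : G.edgeSet → ℕ
  corner : G.edgeSet → ℕ → ℂ
  point_injective : Function.Injective point
  edge_eq : ∀ e : G.edgeSet, (e : Sym2 V) = s(tail e, head e)
  corner_zero : ∀ e, corner e 0 = point (tail e)
  corner_length : ∀ e, corner e (length e) = point (head e)
  isSimpleChain : ∀ e, IsSimpleChain (length e) (corner e)
  mem_of_point_mem : ∀ e, ∀ i < length e, ∀ w,
    point w ∈ segment ℝ (corner e i) (corner e (i + 1)) → w ∈ (e : Sym2 V)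
  no_crossing : ∀ e f, e ≠ f → ∀ i < length e, ∀ j < length f,
    ∀ x ∈ segment ℝ (corner e i) (corner e (i + 1)),
      x ∈ segment ℝ (corner f j) (corner f (j + 1)) →
        ∃ w : V, w ∈ (e : Sym2 V) ∧ w ∈ (f : Sym2 V) ∧ x = point w

theorem nonempty_simpleDrawing_of_isPlanar {V : Type*} {G : SimpleGraph V} (hG : G.IsPlanar) :
    Nonempty (SimpleDrawing G) := by
  obtain ⟨point, curve, h⟩ := hG
  let φ : Plane ≃ₗ[ℝ] ℂ := Complex.orthonormalBasisOneI.repr.symm.toLinearEquiv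
  have hends (e : G.edgeSet) : ∃ u v : V, (e : Sym2 V) = s(u, v) :=
    Sym2.ind (fun u v => ⟨u, v, rfl⟩) (e : Sym2 V)
  choose tail head hth using hends
  have hcurve (e : G.edgeSet) : IsPolygonalCurve (point (tail e)) (point (head e)) (curve e) := by
    have hadj : G.Adj (tail e) (head e) := by
      rw [← SimpleGraph.mem_edgeSet, ← hth e]
      exact e.2
    have hcurve := h.isPolygonalCurve _ _ hadj
    rwa [show (⟨s(tail e, head e), hadj⟩ : G.edgeSet) = e from Subtype.ext (hth e).symm] at hcurve
  choose n p hp0 hpn hpS hsimple using fun e => (hcurve e).exists_isSimpleChain φ.toLinearMap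
  refine ⟨⟨φ ∘ point, tail, head, n, p, φ.injective.comp h.point_injective, hth, hp0, hpn, hsimple,
    fun e i hi w hw => ?_, fun e f hef i hi j hj x hxe hxf => ?_⟩⟩
  · obtain ⟨y, hy, hyw⟩ := hpS e i hi hw
    exact h.mem_of_point_mem e w (φ.injective hyw ▸ hy)
  · obtain ⟨y, hye, rfl⟩ := hpS e i hi hxe
    obtain ⟨y', hyf, hyy⟩ := hpS f j hj hxf
    obtain ⟨w, hwe, hwf, rfl⟩ := h.no_crossing e f hef y ⟨hye, φ.injective hyy ▸ hyf⟩
    exact ⟨w, hwe, hwf, rfl⟩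

theorem IsSegmentFamily.touches_of_touches {K : Type*} [Finite K] {a b : K → ℂ} {U : Set ℂ}
    (h : IsSegmentFamily a b) (hU : IsFace (segmentUnion a b) U) {k l : K} {q : ℂ}
    (hqk : q = a k ∨ q = b k) (hlk : l ≠ k) (hql : q ∈ segment ℝ (a l) (b l))
    (honly : ∀ m, q ∈ segment ℝ (a m) (b m) → m = k ∨ m = l) (ht : Touches U (a k) (b k)) :
    Touches U (a l) (b l) := by
  have hqU : q ∈ closure U := by
    refine h.segment_subset_closure hU ht ?_
    rcases hqk with rfl | rfl
    exacts [left_mem_segment ℝ _ _, right_mem_segment ℝ _ _]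
  obtain ⟨m, hmk, hqm, hm⟩ := h.exists_touches_of_end hqk hU hqU hlk hql
  obtain rfl := (honly m hqm).resolve_left hmk
  exact hm

namespace SimpleDrawing

variable {V : Type*} {G : SimpleGraph V} (D : SimpleDrawing G) {U : Set ℂ} {e f : G.edgeSet}

theorem tail_ne_head (e : G.edgeSet) : D.tail e ≠ D.head e := by
  have h := e.2
  rw [D.edge_eq e] at h
  exact SimpleGraph.Adj.ne h

theorem length_pos (e : G.edgeSet) : 0 < D.length e := by
  by_contra! h0
  have h := D.corner_length e
  rw [Nat.le_zero.1 h0, D.corner_zero] at h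
  exact D.tail_ne_head e (D.point_injective h)

theorem point_eq_corner_of_mem {w : V} (hw : w ∈ (e : Sym2 V)) :
    D.point w = D.corner e 0 ∨ D.point w = D.corner e (D.length e) := by
  rw [D.edge_eq e, Sym2.mem_iff] at hw
  rcases hw with rfl | rfl
  exacts [Or.inl (D.corner_zero e).symm, Or.inr (D.corner_length e).symm]

/-- The segments of all edges of a drawing: `⟨e, i⟩` stands for the segment from `corner e i` to
`corner e (i + 1)`. -/
abbrev Segment : Type _ := Σ e, Fin (D.length e)

/-- The first end of a segment. -/
def left (k : D.Segment) : ℂ := D.corner k.1 k.2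

/-- The second end of a segment. -/
def right (k : D.Segment) : ℂ := D.corner k.1 (k.2 + 1)

/-- The set of points of a drawing. -/
def carrier : Set ℂ := segmentUnion D.left D.right

theorem isSegmentFamily : IsSegmentFamily D.left D.right where
  ne k := (D.isSimpleChain k.1).ne k.2 k.2.2
  eq_end := by
    rintro ⟨e, i, hi⟩ ⟨f, j, hj⟩ hkl x hxe hxf
    dsimp only [left, right] at *
    have hchain := D.isSimpleChain e
    by_cases hef : e = f
    · subst hef
      rcases lt_trichotomy i j with hij | rfl | hji
      · exact Or.inr (hchain.eq_succ i j hij hj x hxe hxf).2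
      · exact absurd rfl hkl
      · obtain ⟨rfl, hx⟩ := hchain.eq_succ j i hji hi x hxf hxe
        exact Or.inl hx
    · obtain ⟨w, hwe, -, rfl⟩ := D.no_crossing e f hef i hi j hj x hxe hxf
      rcases D.point_eq_corner_of_mem hwe with hw | hw <;> rw [hw] at hxe ⊢
      · exact Or.inl (by rw [hchain.eq_zero_of_start_mem hi hxe])
      · exact Or.inr (by rw [hchain.succ_eq_of_finish_mem hi hxe])

theorem eq_of_corner_mem {i j : ℕ} (hi : i + 1 < D.length e) (hj : j < D.length f)
    (hm : D.corner e (i + 1) ∈ segment ℝ (D.corner f j) (D.corner f (j + 1))) : f = e := by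
  by_contra hfe
  obtain ⟨w, hw, -, hx⟩ := D.no_crossing e f (Ne.symm hfe) i (by lia) j hj _
    (right_mem_segment ℝ _ _) hm
  rcases D.point_eq_corner_of_mem hw with h | h
  · have h0 := (D.isSimpleChain e).eq_zero_of_start_mem hi
      (by rw [← h, ← hx]; exact left_mem_segment ℝ _ _)
    lia
  · have hlast := (D.isSimpleChain e).succ_eq_of_finish_mem (i := i) (by lia)
      (by rw [← h, ← hx]; exact right_mem_segment ℝ _ _)
    lia

theorem eq_or_eq_of_corner_mem {i : ℕ} (hi : i + 1 < D.length e) {k : D.Segment}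
    (hm : D.corner e (i + 1) ∈ segment ℝ (D.left k) (D.right k)) :
    k = ⟨e, i, i.lt_succ_self.trans hi⟩ ∨ k = ⟨e, i + 1, hi⟩ := by
  obtain ⟨f, j, hj⟩ := k
  obtain rfl := D.eq_of_corner_mem hi hj hm
  rcases (D.isSimpleChain f).eq_or_eq_succ_of_corner_mem (by lia) hj hm with rfl | rfl
  exacts [Or.inl rfl, Or.inr rfl]

theorem exists_segment_of_mem {v : V} (hv : v ∈ (e : Sym2 V)) :
    ∃ i : Fin (D.length e), (D.point v = D.left ⟨e, i⟩ ∨ D.point v = D.right ⟨e, i⟩) ∧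
      ∀ j : Fin (D.length e), D.point v ∈ segment ℝ (D.left ⟨e, j⟩) (D.right ⟨e, j⟩) → j = i := by
  have hpos := D.length_pos e
  have hchain := D.isSimpleChain e
  rcases D.point_eq_corner_of_mem hv with h | h <;> rw [h]
  · exact ⟨⟨0, hpos⟩, Or.inl rfl, fun j hj => Fin.ext (hchain.eq_zero_of_start_mem j.2 hj)⟩
  · refine ⟨⟨D.length e - 1, by lia⟩, Or.inr ?_, fun j hj => Fin.ext ?_⟩
    · rw [right, Nat.sub_add_cancel hpos]
    · have := hchain.succ_eq_of_finish_mem j.2 hj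
      lia

/-- A face touches an edge if it touches one of the segments of that edge. -/
def TouchesEdge (U : Set ℂ) (e : G.edgeSet) : Prop :=
  ∃ i : Fin (D.length e), Touches U (D.left ⟨e, i⟩) (D.right ⟨e, i⟩)

/-- The faces of a drawing that touch at least one edge. -/
def touchingFaces : Set (Set ℂ) := {U | IsFace D.carrier U ∧ ∃ e, D.TouchesEdge U e}

variable {D} [Finite G.edgeSet]

theorem touches_succ_iff (hU : IsFace D.carrier U) {i : ℕ} (hi : i + 1 < D.length e) :
    Touches U (D.corner e i) (D.corner e (i + 1)) ↔
      Touches U (D.corner e (i + 1)) (D.corner e (i + 1 + 1)) := by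
  have hF := D.isSegmentFamily
  let k : D.Segment := ⟨e, i, i.lt_succ_self.trans hi⟩
  let l : D.Segment := ⟨e, i + 1, hi⟩
  have hkl : k ≠ l := by simp [k, l]
  constructor
  · exact hF.touches_of_touches hU (k := k) (l := l) (Or.inr rfl) hkl.symm
      (left_mem_segment ℝ _ _) fun m => D.eq_or_eq_of_corner_mem hi
  · exact hF.touches_of_touches hU (k := l) (l := k) (Or.inl rfl) hkl
      (right_mem_segment ℝ _ _) fun m hm => (D.eq_or_eq_of_corner_mem hi hm).symm

theorem TouchesEdge.touches (ht : D.TouchesEdge U e) (hU : IsFace D.carrier U)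
    (i : Fin (D.length e)) : Touches U (D.left ⟨e, i⟩) (D.right ⟨e, i⟩) := by
  have hiff : ∀ i < D.length e, (Touches U (D.corner e i) (D.corner e (i + 1)) ↔
      Touches U (D.corner e 0) (D.corner e (0 + 1))) := by
    intro i
    induction i with
    | zero => exact fun _ => Iff.rfl
    | succ i ih => exact fun hi => (touches_succ_iff hU hi).symm.trans (ih (by lia))
  obtain ⟨j, hj⟩ := ht
  exact (hiff i i.2).2 ((hiff j j.2).1 hj)

theorem TouchesEdge.exists_touchesEdge (ht : D.TouchesEdge U e) (hU : IsFace D.carrier U) {v : V}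
    (hve : v ∈ (e : Sym2 V)) (hfe : f ≠ e) (hvf : v ∈ (f : Sym2 V)) :
    ∃ g ≠ e, v ∈ (g : Sym2 V) ∧ D.TouchesEdge U g := by
  obtain ⟨i, hi, hi_unique⟩ := D.exists_segment_of_mem hve
  obtain ⟨j, hj, -⟩ := D.exists_segment_of_mem hvf
  have mem_segment {q x y : ℂ} (h : q = x ∨ q = y) : q ∈ segment ℝ x y := by
    rcases h with rfl | rfl
    exacts [left_mem_segment ℝ _ _, right_mem_segment ℝ _ _]
  obtain ⟨⟨g, m⟩, hne, hvm, hm⟩ := D.isSegmentFamily.exists_touches_of_end (k := ⟨e, i⟩)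
    (l₀ := ⟨f, j⟩) hi hU (D.isSegmentFamily.segment_subset_closure hU (ht.touches hU i)
      (mem_segment hi)) (fun h => hfe (congrArg Sigma.fst h)) (mem_segment hj)
  refine ⟨g, ?_, D.mem_of_point_mem g m m.2 v hvm, m, hm⟩
  rintro rfl
  exact hne (by rw [hi_unique m hvm])

theorem exists_two_faces (D : SimpleDrawing G) (e : G.edgeSet) :
    ∃ U₁ U₂, ∀ U, IsFace D.carrier U → D.TouchesEdge U e → U = U₁ ∨ U = U₂ := by
  obtain ⟨U₁, U₂, h12⟩ := D.isSegmentFamily.exists_two_faces ⟨e, 0, D.length_pos e⟩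
  exact ⟨U₁, U₂, fun U hU ht => h12 U hU (ht.touches hU _)⟩

theorem finite_touchingFaces (D : SimpleDrawing G) : D.touchingFaces.Finite := by
  choose U₁ U₂ h12 using D.exists_two_faces
  refine ((Set.finite_range U₁).union (Set.finite_range U₂)).subset ?_
  rintro U ⟨hU, e, he⟩
  exact (h12 e U hU he).imp (fun h => ⟨e, h.symm⟩) fun h => ⟨e, h.symm⟩

theorem TouchesEdge.exists_three (ht : D.TouchesEdge U e) (hU : IsFace D.carrier U)
    (hdeg : ∀ v ∈ (e : Sym2 V), ∃ f ≠ e, v ∈ (f : Sym2 V)) :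
    ∃ f g, e ≠ f ∧ e ≠ g ∧ f ≠ g ∧ D.TouchesEdge U f ∧ D.TouchesEdge U g := by
  have htail : D.tail e ∈ (e : Sym2 V) := D.edge_eq e ▸ Sym2.mem_mk_left _ _
  have hhead : D.head e ∈ (e : Sym2 V) := D.edge_eq e ▸ Sym2.mem_mk_right _ _
  obtain ⟨f₀, hf₀, hvf₀⟩ := hdeg _ htail
  obtain ⟨g₀, hg₀, hvg₀⟩ := hdeg _ hhead
  obtain ⟨f, hfe, htf, hf⟩ := ht.exists_touchesEdge hU htail hf₀ hvf₀
  obtain ⟨g, hge, hhg, hg⟩ := ht.exists_touchesEdge hU hhead hg₀ hvg₀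
  refine ⟨f, g, hfe.symm, hge.symm, ?_, hf, hg⟩
  rintro rfl
  refine hfe (Subtype.ext ?_)
  rw [D.edge_eq e]
  exact (Sym2.mem_and_mem_iff (D.tail_ne_head e)).1 ⟨htf, hhg⟩

theorem three_mul_ncard_touchingFaces_le (D : SimpleDrawing G)
    (hdeg : ∀ e : G.edgeSet, ∀ v ∈ (e : Sym2 V), ∃ f ≠ e, v ∈ (f : Sym2 V)) :
    D.touchingFaces.ncard * 3 ≤ Nat.card G.edgeSet * 2 := by
  classical
  have := Fintype.ofFinite G.edgeSet
  rw [Set.ncard_eq_toFinset_card _ D.finite_touchingFaces, Nat.card_eq_fintype_card,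
    ← Finset.card_univ]
  refine Finset.card_mul_le_card_mul D.TouchesEdge (fun U hU => ?_) fun e _ => ?_
  · obtain ⟨hU, e, he⟩ := D.finite_touchingFaces.mem_toFinset.1 hU
    obtain ⟨f, g, hef, heg, hfg, hf, hg⟩ := he.exists_three hU (hdeg e)
    rw [← Finset.card_eq_three.2 ⟨e, f, g, hef, heg, hfg, rfl⟩]
    refine Finset.card_le_card fun x hx =>
      (Finset.mem_bipartiteAbove _).2 ⟨Finset.mem_univ x, ?_⟩
    simp only [Finset.mem_insert, Finset.mem_singleton] at hx
    rcases hx with rfl | rfl | rfl <;> assumption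
  · obtain ⟨U₁, U₂, h12⟩ := D.exists_two_faces e
    refine (Finset.card_le_card (t := {U₁, U₂}) fun U hU => ?_).trans Finset.card_le_two
    rw [Finset.mem_bipartiteBelow, Set.Finite.mem_toFinset] at hU
    simpa only [Finset.mem_insert, Finset.mem_singleton] using h12 U hU.1.1 hU.2

end SimpleDrawing

section CycleSpace

variable {R V E : Type*} [Fintype V] [Fintype E] [DecidableEq V] (tail head : E → V)

/-- The boundary of a weighting of edges that are directed from `tail` to `head`. Its kernel is the
cycle space. -/
def boundaryMap (R : Type*) [CommRing R] : (E → R) →ₗ[R] (V → R) :=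
  Fintype.linearCombination R fun e => Pi.single (tail e) 1 - Pi.single (head e) 1

theorem sum_boundaryMap_mul [CommRing R] (z : E → R) (g : V → R) :
    ∑ v, boundaryMap tail head R z v * g v = ∑ e, z e * (g (tail e) - g (head e)) := by
  simp only [boundaryMap, Fintype.linearCombination_apply, Finset.sum_apply, Pi.smul_apply,
    Pi.sub_apply, smul_eq_mul, Finset.sum_mul]
  rw [Finset.sum_comm]
  simp only [mul_assoc, ← Finset.mul_sum, sub_mul, Finset.sum_sub_distrib, Pi.single_apply,
    ite_mul, one_mul, zero_mul, Finset.sum_ite_eq', Finset.mem_univ, if_true]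

theorem card_add_one_le_finrank_ker_boundaryMap (R : Type*) [Field R] [Nonempty V] :
    Fintype.card E + 1 ≤
      finrank R (LinearMap.ker (boundaryMap tail head R)) + Fintype.card V := by
  have hrank := (boundaryMap tail head R).finrank_range_add_finrank_ker
  have hrange : finrank R (LinearMap.range (boundaryMap tail head R)) < Fintype.card V := by
    rw [← finrank_fintype_fun_eq_card (R := R) (η := V)]
    refine Submodule.finrank_lt fun htop => ?_
    obtain ⟨v⟩ := ‹Nonempty V›
    obtain ⟨z, hz⟩ := LinearMap.range_eq_top.1 htop (Pi.single v 1)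
    have hsum := sum_boundaryMap_mul tail head z 1
    simp [hz] at hsum
  rw [finrank_fintype_fun_eq_card] at hrank
  lia

end CycleSpace

namespace SimpleDrawing

variable {V : Type*} [Finite V] [DecidableEq V] {G : SimpleGraph V} [Fintype G.edgeSet]
  (D : SimpleDrawing G)

theorem isCycle {z : G.edgeSet → ℂ} (hz : boundaryMap D.tail D.head ℂ z = 0) :
    IsCycle D.left D.right fun k => z k.1 := by
  have := Fintype.ofFinite V
  intro f
  have htelescope (e : G.edgeSet) : ∑ i : Fin (D.length e), (f (D.left ⟨e, i⟩) - f (D.right ⟨e, i⟩))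
      = f (D.point (D.tail e)) - f (D.point (D.head e)) := by
    rw [← D.corner_zero, ← D.corner_length, ← Finset.sum_range_sub' fun i => f (D.corner e i),
      ← Fin.sum_univ_eq_sum_range (fun i => f (D.corner e i) - f (D.corner e (i + 1)))]
    rfl
  have hsum := sum_boundaryMap_mul D.tail D.head z (f ∘ D.point)
  simp only [hz, Pi.zero_apply, zero_mul, Finset.sum_const_zero, Function.comp_apply] at hsum
  simp only [Fintype.sum_sigma, ← Finset.mul_sum, htelescope, ← hsum]

theorem finrank_ker_boundaryMap_le :
    finrank ℂ (LinearMap.ker (boundaryMap D.tail D.head ℂ)) ≤ D.touchingFaces.ncard := by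
  have := D.finite_touchingFaces.fintype
  choose base hbase using fun U : D.touchingFaces => U.2.1.nonempty
  let windings : (G.edgeSet → ℂ) →ₗ[ℂ] (D.touchingFaces → ℂ) :=
    LinearMap.pi fun U => winding D.left D.right (base U) ∘ₗ LinearMap.funLeft ℂ ℂ Sigma.fst
  have hinj : Function.Injective
      (windings.domRestrict (LinearMap.ker (boundaryMap D.tail D.head ℂ))) := by
    rw [← LinearMap.ker_eq_bot, LinearMap.ker_eq_bot']
    rintro ⟨z, hz⟩ hwind
    ext e
    refine D.isSegmentFamily.eq_zero_of_winding_eq_zero (z := fun k => z k.1)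
      (k := ⟨e, 0, D.length_pos e⟩) fun U hU ht p hp => ?_
    let U' : D.touchingFaces := ⟨U, hU, e, _, ht⟩
    rw [hU.winding_eq (D.isCycle hz) hp (hbase U')]
    exact congrFun hwind U'
  have hle := LinearMap.finrank_le_finrank_of_injective hinj
  rwa [finrank_fintype_fun_eq_card, ← Nat.card_eq_fintype_card, Nat.card_coe_set_eq] at hle

end SimpleDrawing

section Planar

variable {V W : Type*} {G : SimpleGraph V}

theorem card_edgeSet_lt_of_isPlanar [Finite V] [Nonempty V] (hG : G.IsPlanar)
    (hdeg : ∀ e : G.edgeSet, ∀ v ∈ (e : Sym2 V), ∃ f ≠ e, v ∈ (f : Sym2 V)) :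
    Nat.card G.edgeSet < 3 * Nat.card V := by
  classical
  have := Fintype.ofFinite V
  obtain ⟨D⟩ := nonempty_simpleDrawing_of_isPlanar hG
  have hcycles := card_add_one_le_finrank_ker_boundaryMap D.tail D.head ℂ
  have hfaces := D.finrank_ker_boundaryMap_le
  have htouch := D.three_mul_ncard_touchingFaces_le hdeg
  simp only [Nat.card_eq_fintype_card] at htouch ⊢
  lia

theorem isPlanar_of_injective_hom {G' : SimpleGraph W} (hG : G.IsPlanar) (f : G' →g G)
    (hf : Function.Injective f) : G'.IsPlanar := by
  obtain ⟨point, curve, h⟩ := hG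
  refine ⟨point ∘ f, fun e => curve (f.mapEdgeSet e), h.point_injective.comp hf,
    fun u v huv => h.isPolygonalCurve _ _ (f.map_adj huv), fun e w hw => ?_,
    fun e e' hee x hx => ?_⟩
  · obtain ⟨w', hw', hww⟩ := Sym2.mem_map.1 (h.mem_of_point_mem _ _ hw)
    exact hf hww ▸ hw'
  · obtain ⟨w, hw, hw', rfl⟩ := h.no_crossing _ _
      (fun heq => hee (SimpleGraph.Hom.mapEdgeSet.injective f hf heq)) x hx
    obtain ⟨u, hu, rfl⟩ := Sym2.mem_map.1 hw
    obtain ⟨u', hu', huu⟩ := Sym2.mem_map.1 hw'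
    exact ⟨u, hu, hf huu ▸ hu', rfl⟩

theorem exists_degree_le_five_of_isPlanar [Fintype V] [Nonempty V] [DecidableRel G.Adj]
    (hG : G.IsPlanar) : ∃ v, G.degree v ≤ 5 := by
  classical
  by_contra! hdeg
  have hlt := card_edgeSet_lt_of_isPlanar hG fun e v _ => by
    have hcard : 1 < (G.incidenceFinset v).card := by
      rw [SimpleGraph.card_incidenceFinset_eq_degree]
      exact Nat.one_lt_ofNat.trans_le (hdeg v)
    obtain ⟨f, hf, hfe⟩ := Finset.exists_mem_ne hcard (e : Sym2 V)
    rw [SimpleGraph.mem_incidenceFinset] at hf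
    exact ⟨⟨f, hf.1⟩, fun h => hfe (congrArg Subtype.val h), hf.2⟩
  have hsum := G.sum_degrees_eq_twice_card_edges
  have hge : ∑ _v : V, 6 ≤ ∑ v, G.degree v := Finset.sum_le_sum fun v _ => hdeg v
  rw [Finset.sum_const, Finset.card_univ, smul_eq_mul] at hge
  rw [Nat.card_eq_fintype_card, Nat.card_eq_fintype_card, ← SimpleGraph.edgeFinset_card] at hlt
  lia

/-- A graph is `s`-degenerate if each of its finite nonempty sets `W` of vertices contains one with
at most `s` neighbors in `W`. -/
def IsDegenerate (G : SimpleGraph V) (s : ℕ) : Prop :=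
  ∀ W : Set V, W.Finite → W.Nonempty → ∃ v ∈ W, (G.neighborSet v ∩ W).ncard ≤ s

theorem isDegenerate_five_of_isPlanar (hG : G.IsPlanar) : IsDegenerate G 5 := by
  classical
  intro W hfin hne
  have := hfin.fintype
  have := hne.to_subtype
  obtain ⟨v, hv⟩ := exists_degree_le_five_of_isPlanar
    (isPlanar_of_injective_hom hG (SimpleGraph.Embedding.induce W).toHom Subtype.val_injective)
  refine ⟨v, v.2, ?_⟩
  have himage : G.neighborSet v ∩ W = Subtype.val '' (G.induce W).neighborSet v := by
    ext w
    simp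
  rwa [himage, Set.ncard_image_of_injective _ Subtype.val_injective, Set.ncard_eq_toFinset_card']

end Planar

theorem exists_coloring_extending {X Y α : Type*} [Finite X] [Nonempty α] {T : SimpleGraph X}
    {ι : Y → X} (hι : Function.Injective ι) (c₀ : (T.comap ι).Coloring α)
    (h : ∀ B, Set.range ι ⊂ B → ∃ x ∈ B, x ∉ Set.range ι ∧
      (T.neighborSet x ∩ B).ncard < Nat.card α) :
    ∃ c : T.Coloring α, ∀ y, c (ι y) = c₀ y := by
  classical
  suffices hB : ∀ B, Set.range ι ⊆ B → ∃ c : X → α,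
      (∀ x ∈ B, ∀ y ∈ B, T.Adj x y → c x ≠ c y) ∧ ∀ y, c (ι y) = c₀ y by
    obtain ⟨c, hc, hc₀⟩ := hB Set.univ (Set.subset_univ _)
    exact ⟨.mk c fun {x y} => hc x trivial y trivial, hc₀⟩
  intro B hB
  induction B using WellFoundedLT.induction with | ind B ih => ?_
  rcases hB.eq_or_ssubset with rfl | hlt
  · refine ⟨Function.extend ι c₀ fun _ => Classical.arbitrary α, ?_, hι.extend_apply _ _⟩
    rintro _ ⟨x, rfl⟩ _ ⟨y, rfl⟩ hxy
    rw [hι.extend_apply, hι.extend_apply]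
    exact c₀.valid hxy
  · obtain ⟨x, hxB, hxι, hx⟩ := h B hlt
    obtain ⟨c, hc, hc₀⟩ := ih (B \ {x}) (Set.sdiff_singleton_ssubset.2 hxB)
      (Set.subset_sdiff_singleton hB hxι)
    obtain ⟨a, ha⟩ : ∃ a, a ∉ c '' (T.neighborSet x ∩ B) := by
      by_contra! hall
      rw [← Set.ncard_univ, ← Set.eq_univ_of_forall hall] at hx
      exact hx.not_ge Set.ncard_image_le
    have hnew : ∀ y ∈ B, T.Adj x y → c y ≠ a := fun y hy hxy hcy => ha ⟨y, ⟨hxy, hy⟩, hcy⟩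
    refine ⟨Function.update c x a, fun y hy z hz hyz => ?_, fun y => ?_⟩
    · by_cases hyx : y = x
      · subst hyx
        rw [Function.update_self, Function.update_of_ne hyz.ne']
        exact (hnew z hz hyz).symm
      · by_cases hzx : z = x
        · subst hzx
          rw [Function.update_self, Function.update_of_ne hyx]
          exact hnew y hy hyz.symm
        · rw [Function.update_of_ne hyx, Function.update_of_ne hzx]
          exact hc y ⟨hy, hyx⟩ z ⟨hz, hzx⟩ hyz
    · rw [Function.update_of_ne fun hy => hxι ⟨y, hy⟩, hc₀]

section Total

variable {V : Type*} {G : SimpleGraph V} {H : G.Subgraph} {k : ℕ}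

/-- The graph on the vertices and edges of `G` whose proper colorings are the total colorings
of `G`. -/
def totalGraph (G : SimpleGraph V) : SimpleGraph (V ⊕ G.edgeSet) where
  Adj
    | .inl u, .inl v => G.Adj u v
    | .inr e, .inr f => G.lineGraph.Adj e f
    | .inl v, .inr e => v ∈ (e : Sym2 V)
    | .inr e, .inl v => v ∈ (e : Sym2 V)
  symm := ⟨by
    rintro (u | e) (v | f) h
    exacts [SimpleGraph.Adj.symm h, h, h, SimpleGraph.Adj.symm h]⟩
  loopless := ⟨by
    rintro (v | e) h
    exacts [G.irrefl h, G.lineGraph.irrefl h]⟩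

theorem mem_mapEdgeSet_iff {v : H.verts} {e : H.coe.edgeSet} :
    (v : V) ∈ (H.hom.mapEdgeSet e : Sym2 V) ↔ v ∈ (e : Sym2 H.verts) :=
  Sym2.mem_map.trans ⟨fun ⟨_, hu, huv⟩ => Subtype.ext huv ▸ hu, fun hv => ⟨v, hv, rfl⟩⟩

theorem mem_edgeSet_of_mem_range_mapEdgeSet {e : G.edgeSet} (he : e ∈ Set.range H.hom.mapEdgeSet) :
    (e : Sym2 V) ∈ H.edgeSet := by
  obtain ⟨⟨e, he⟩, rfl⟩ := he
  induction e with | _ u v => exact he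

/-- The vertices and edges of a subgraph, among those of the whole graph. -/
def inclusionMap (H : G.Subgraph) : H.verts ⊕ H.coe.edgeSet → V ⊕ G.edgeSet :=
  Sum.map Subtype.val H.hom.mapEdgeSet

theorem inclusionMap_injective (H : G.Subgraph) : Function.Injective (inclusionMap H) :=
  Subtype.val_injective.sumMap (SimpleGraph.Hom.mapEdgeSet.injective _ Subtype.val_injective)

/-- The proper coloring of a part of the total graph of `G` that is given by a total coloring of a
subgraph in `G`. -/
def TotalColoring.toColoringComap (φ : TotalColoring H.coe k) (hφ : φ.IsColoringIn) :
    ((totalGraph G).comap (inclusionMap H)).Coloring (Fin k) :=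
  .mk (Sum.elim φ.vert φ.edge) <| by
    rintro (u | e) (v | f) h
    · exact hφ u v h
    · exact (φ.edge_ne_vert f u (mem_mapEdgeSet_iff.1 h)).symm
    · exact φ.edge_ne_vert e v (mem_mapEdgeSet_iff.1 h)
    · obtain ⟨hne, v, hve, hvf⟩ := h
      obtain ⟨u, hu, rfl⟩ := Sym2.mem_map.1 hve
      exact φ.edge.valid ⟨fun hef => hne (hef ▸ rfl), u, hu, mem_mapEdgeSet_iff.1 hvf⟩

/-- A proper coloring of the total graph of `G`, as a total coloring of `G`. -/
def TotalColoring.ofTotalGraph (c : (totalGraph G).Coloring (Fin k)) : TotalColoring G k where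
  vert := .mk (fun v => c (.inl v)) fun h => c.valid (v := .inl _) (w := .inl _) h
  edge := .mk (fun e => c (.inr e)) fun h => c.valid (v := .inr _) (w := .inr _) h
  edge_ne_vert e v hv := c.valid (v := .inr e) (w := .inl v) hv

/-- The edges in `F` at the vertex `v`. -/
def edgesAt (F : Set G.edgeSet) (v : V) : Set G.edgeSet := {f ∈ F | v ∈ (f : Sym2 V)}

variable [Finite V] {s Δ d : ℕ} {v w : V}

theorem ncard_edgesAt_le {F : Set G.edgeSet} {N : Set V}
    (hN : ∀ w (h : G.Adj v w), ⟨s(v, w), h⟩ ∈ F → w ∈ N) : (edgesAt F v).ncard ≤ N.ncard := by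
  rw [← Set.ncard_image_of_injective _ Subtype.val_injective]
  refine le_trans (Set.ncard_le_ncard ?_ (Set.toFinite _)) (Set.ncard_image_le (f := (s(v, ·))))
  rintro _ ⟨⟨f, hf⟩, ⟨hfF, hv⟩, rfl⟩
  obtain ⟨w, rfl⟩ := Sym2.mem_iff_exists.1 hv
  exact ⟨w, hN w hf hfF, rfl⟩

theorem exists_ncard_edgesAt_le_of_isDegenerate (hG : IsDegenerate G s) {C : Set G.edgeSet}
    (hC : C.Nonempty) : ∃ e ∈ C, ∃ v ∈ (e : Sym2 V), (edgesAt C v).ncard ≤ s := by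
  obtain ⟨v, ⟨e, he, hve⟩, hv⟩ := hG {v | ∃ e ∈ C, v ∈ (e : Sym2 V)} (Set.toFinite _) <| by
    obtain ⟨e, he⟩ := hC
    exact ⟨_, e, he, Sym2.out_fst_mem _⟩
  refine ⟨e, he, v, hve, le_trans (ncard_edgesAt_le fun w hvw hw => ?_) hv⟩
  exact ⟨hvw, _, hw, Sym2.mem_mk_right v w⟩

theorem ncard_edgesAt_range_mapEdgeSet_le (H : G.Subgraph) (v : V) :
    (edgesAt (Set.range H.hom.mapEdgeSet) v).ncard ≤ (H.neighborSet v).ncard :=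
  ncard_edgesAt_le fun _ _ hw => mem_edgeSet_of_mem_range_mapEdgeSet hw

theorem ncard_neighborSet_inl_inter_le (v : V) (B : Set (V ⊕ G.edgeSet)) :
    ((totalGraph G).neighborSet (.inl v) ∩ B).ncard ≤
      (G.neighborSet v).ncard + (edgesAt (Sum.inr ⁻¹' B) v).ncard := by
  rw [← Set.ncard_image_of_injective (G.neighborSet v) Sum.inl_injective,
    ← Set.ncard_image_of_injective (edgesAt (Sum.inr ⁻¹' B) v) Sum.inr_injective]
  refine le_trans (Set.ncard_le_ncard ?_ (Set.toFinite _)) (Set.ncard_union_le _ _)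
  rintro (w | f) ⟨hadj, hB⟩
  exacts [Or.inl ⟨w, hadj, rfl⟩, Or.inr ⟨f, ⟨hB, hadj⟩, rfl⟩]

theorem ncard_neighborSet_inr_inter_le {e : G.edgeSet} (he : (e : Sym2 V) = s(v, w))
    (B : Set (V ⊕ G.edgeSet)) :
    ((totalGraph G).neighborSet (.inr e) ∩ B).ncard ≤
      2 + ((edgesAt (Sum.inr ⁻¹' B) v \ {e}).ncard + (edgesAt Set.univ w \ {e}).ncard) := by
  set Fv := edgesAt (Sum.inr ⁻¹' B) v \ {e}
  set Fw := edgesAt Set.univ w \ {e}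
  have hsub : (totalGraph G).neighborSet (.inr e) ∩ B ⊆
      Sum.inl '' {v, w} ∪ Sum.inr '' (Fv ∪ Fw) := by
    rintro (u | f) ⟨hadj, hB⟩
    · have hu : u ∈ (e : Sym2 V) := hadj
      rw [he, Sym2.mem_iff] at hu
      exact Or.inl ⟨u, hu, rfl⟩
    · obtain ⟨hne, u, hue, huf⟩ := hadj
      rw [he] at hue
      rcases Sym2.mem_iff.1 hue with rfl | rfl
      · exact Or.inr ⟨f, Or.inl ⟨⟨hB, huf⟩, hne.symm⟩, rfl⟩
      · exact Or.inr ⟨f, Or.inr ⟨⟨trivial, huf⟩, hne.symm⟩, rfl⟩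
  refine (Set.ncard_le_ncard hsub (Set.toFinite _)).trans ((Set.ncard_union_le _ _).trans ?_)
  rw [Set.ncard_image_of_injective _ Sum.inl_injective,
    Set.ncard_image_of_injective _ Sum.inr_injective]
  refine Nat.add_le_add ((Set.ncard_insert_le v {w}).trans_eq ?_) (Set.ncard_union_le _ _)
  rw [Set.ncard_singleton]

theorem exists_ncard_neighborSet_inter_lt (hG : IsDegenerate G s)
    (hΔ : ∀ v, (G.neighborSet v).ncard ≤ Δ) (hd : ∀ v, (H.neighborSet v).ncard ≤ d)
    (hk : Δ + d + s < k) {B : Set (V ⊕ G.edgeSet)} (hB : Set.range (inclusionMap H) ⊂ B) :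
    ∃ x ∈ B, x ∉ Set.range (inclusionMap H) ∧
      ((totalGraph G).neighborSet x ∩ B).ncard < k := by
  set F := Set.range H.hom.mapEdgeSet
  set C := (Sum.inr ⁻¹' B) \ F
  have hBv (v : V) : edgesAt (Sum.inr ⁻¹' B) v ⊆ edgesAt C v ∪ edgesAt F v :=
    fun f ⟨hfB, hv⟩ => (em (f ∈ F)).elim (fun hf => Or.inr ⟨hf, hv⟩)
      fun hf => Or.inl ⟨⟨hfB, hf⟩, hv⟩
  have hF (v : V) : (edgesAt F v).ncard ≤ d :=
    (ncard_edgesAt_range_mapEdgeSet_le H v).trans (hd v)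
  rcases C.eq_empty_or_nonempty with hC | hC
  · obtain ⟨v | e, hxB, hx⟩ := Set.exists_of_ssubset hB
    · have hcard := (Set.ncard_le_ncard (hBv v) (Set.toFinite _)).trans (Set.ncard_union_le _ _)
      have hCv : (edgesAt C v).ncard = 0 := by simp [hC, edgesAt]
      exact ⟨_, hxB, hx, (ncard_neighborSet_inl_inter_le v B).trans_lt (by linarith [hΔ v, hF v])⟩
    · have heC : e ∈ C := ⟨hxB, fun ⟨f, hf⟩ => hx ⟨.inr f, congrArg Sum.inr hf⟩⟩
      exact absurd heC (hC ▸ Set.notMem_empty e)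
  · obtain ⟨e, heC, v, hve, hCv⟩ := exists_ncard_edgesAt_le_of_isDegenerate hG hC
    obtain ⟨w, he⟩ := Sym2.mem_iff_exists.1 hve
    have hv : (edgesAt (Sum.inr ⁻¹' B) v \ {e}).ncard < s + d := by
      have hsub : edgesAt (Sum.inr ⁻¹' B) v \ {e} ⊆ (edgesAt C v \ {e}) ∪ edgesAt F v :=
        fun f hf => (hBv v hf.1).imp_left fun hfC => ⟨hfC, hf.2⟩
      have := (Set.ncard_le_ncard hsub (Set.toFinite _)).trans (Set.ncard_union_le _ _)
      have := Set.ncard_sdiff_singleton_add_one (a := e) (s := edgesAt C v) ⟨heC, hve⟩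
      linarith [hF v]
    have hw : (edgesAt Set.univ w \ {e}).ncard < Δ := by
      have := Set.ncard_sdiff_singleton_add_one (a := e) (s := edgesAt Set.univ w)
        ⟨trivial, he ▸ Sym2.mem_mk_right v w⟩
      have := ncard_edgesAt_le (F := Set.univ) (N := G.neighborSet w) fun u hu _ => hu
      linarith [hΔ w]
    refine ⟨.inr e, heC.1, ?_, (ncard_neighborSet_inr_inter_le he B).trans_lt (by lia)⟩
    rintro ⟨u | f, hf⟩
    exacts [Sum.inl_ne_inr hf, heC.2 ⟨f, Sum.inr_injective hf⟩]

end Total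

section Main

variable {V : Type*} {G : SimpleGraph V}

theorem ncard_neighborSet_le_maxDegree [Fintype V] [DecidableRel G.Adj] (v : V) :
    (G.neighborSet v).ncard ≤ G.maxDegree := by
  rw [Set.ncard_eq_toFinset_card']
  exact G.degree_le_maxDegree v

theorem ncard_subgraph_neighborSet_le_maxDegree (H : G.Subgraph) [Fintype H.verts]
    [DecidableRel H.coe.Adj] (v : V) : (H.neighborSet v).ncard ≤ H.coe.maxDegree := by
  by_cases hv : v ∈ H.verts
  · have himage : H.neighborSet v = Subtype.val '' H.coe.neighborSet ⟨v, hv⟩ := by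
      ext w
      exact ⟨fun h => ⟨⟨w, h.snd_mem⟩, h, rfl⟩, by rintro ⟨w, h, rfl⟩; exact h⟩
    rw [himage, Set.ncard_image_of_injective _ Subtype.val_injective]
    exact ncard_neighborSet_le_maxDegree _
  · have hempty : H.neighborSet v = ∅ :=
      Set.eq_empty_of_forall_notMem fun w (hw : H.Adj v w) => hv hw.fst_mem
    rw [hempty, Set.ncard_empty]
    exact Nat.zero_le _

theorem mainTheorem3_general [Fintype V] [DecidableRel G.Adj] {s Δ d k : ℕ}
    (hG : IsDegenerate G s) (H : G.Subgraph) [Fintype H.verts] [DecidableRel H.coe.Adj]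
    (hΔ : G.maxDegree ≤ Δ) (hd : H.coe.maxDegree ≤ d) (hk : Δ + d + s < k)
    (φ : TotalColoring H.coe k) (hφ : φ.IsColoringIn) :
    ∃ ψ : TotalColoring G k, ψ.Extends φ := by
  have : NeZero k := ⟨(Nat.zero_le _).trans_lt hk |>.ne'⟩
  obtain ⟨c, hc⟩ := exists_coloring_extending (inclusionMap_injective H) (φ.toColoringComap hφ)
    fun B hB => by
      rw [Nat.card_fin]
      exact exists_ncard_neighborSet_inter_lt hG
        (fun v => (ncard_neighborSet_le_maxDegree v).trans hΔ)
        (fun v => (ncard_subgraph_neighborSet_le_maxDegree H v).trans hd) hk hB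
  exact ⟨.ofTotalGraph c, fun v => hc (.inl v), fun e => hc (.inr e)⟩

end Main

theorem mainTheorem3 {V : Type*} [Fintype V] (G : SimpleGraph V) [DecidableRel G.Adj]
    (hG : G.IsPlanar) (H : G.Subgraph) [Fintype H.verts] [DecidableRel H.coe.Adj]
    (Δ d : ℕ) (hΔ : G.maxDegree = Δ) (hd : H.coe.maxDegree = d)
    (φ : TotalColoring H.coe (Δ + d + 6)) (hφ : φ.IsColoringIn) :
    ∃ ψ : TotalColoring G (Δ + d + 6), ψ.Extends φ :=
  mainTheorem3_general (isDegenerate_five_of_isPlanar hG) H hΔ.le hd.le (by lia) φ hφ
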